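/- Let $\beta=(\beta_n)_{n\ge 0}$ be a non-increasing sequence of positive numbers such that $\liminf_{n\to\infty}\beta_n^{1/n}\ge 1$, and let $H^2(\beta)$ be the space of analytic functions $f(z)=\sum_{n=0}^\infty a_n z^n$ on the open unit disk $\mathbb D$ with $\sum_{n=0}^\infty |a_n|^2\beta_n<\infty$. Let $I_1(z)=\exp\left(-\frac{1+z}{1-z}\right)$ for $z\in\mathbb D$. Assume that the composition operator $C_{I_1}\colon f\mapsto f\circ I_1$ maps $H^2(\beta)$ into itself. Then $\beta$ satisfies the $\Delta_2$-condition: there is a constant $0<\delta<1$ such that $\beta_{2n}\ge\delta\,\beta_n$ for all integers $n\ge 0$. -/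

import Mathlib

open Filter Set

/-- A weight: a sequence of positive numbers with `liminf β n ^ (1 / n) ≥ 1`. The lower limit is
taken in the extended reals, so that it is meaningful for unbounded sequences as well. -/
structure IsHardyWeight (β : ℕ → ℝ) : Prop where
  pos : ∀ n, 0 < β n
  one_le_liminf :
    (1 : EReal) ≤ liminf (fun n : ℕ => ((β n ^ (1 / (n : ℝ)) : ℝ) : EReal)) atTop

/-- The weighted Hardy space `H²(β)`: the functions that are given on the open unit disk by a power
series `∑ a n * z ^ n` with `∑ ‖a n‖ ^ 2 * β n < ∞`. Functions on the disk are represented by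
functions `ℂ → ℂ`, whose values outside the disk play no role. -/
def weightedHardySpace (β : ℕ → ℝ) : Set (ℂ → ℂ) :=
  {f | ∃ a : ℕ → ℂ,
    (∀ z ∈ Metric.ball (0 : ℂ) 1, HasSum (fun n => a n * z ^ n) (f z)) ∧
      Summable (fun n => ‖a n‖ ^ 2 * β n)}

/-- The singular inner function `I_a (z) = exp (-a (1 + z) / (1 - z))`. -/
noncomputable def singularInner (a : ℝ) (z : ℂ) : ℂ :=
  Complex.exp (-(a : ℂ) * ((1 + z) / (1 - z)))

/-- For `a > 0`, `I_a` maps the open unit disk into itself, so that `f ∘ I_a` on the disk depends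
only on `f` on the disk. -/
theorem singularInner_mapsTo {a : ℝ} (ha : 0 < a) :
    MapsTo (singularInner a) (Metric.ball (0 : ℂ) 1) (Metric.ball (0 : ℂ) 1) := by
  intro z hz
  rw [mem_ball_zero_iff] at hz ⊢
  have hne : 1 - z ≠ 0 := by
    intro h
    have h1 : z = 1 := (sub_eq_zero.mp h).symm
    simp [h1] at hz
  have hN : 0 < Complex.normSq (1 - z) := Complex.normSq_pos.mpr hne
  have hz2 : z.re * z.re + z.im * z.im < 1 := by
    rw [← Complex.normSq_apply, Complex.normSq_eq_norm_sq]
    nlinarith [norm_nonneg z]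
  have hre : 0 < ((1 + z) / (1 - z)).re := by
    rw [Complex.div_re, ← add_div]
    apply div_pos _ hN
    simp only [Complex.add_re, Complex.sub_re, Complex.add_im, Complex.sub_im, Complex.one_re,
      Complex.one_im]
    nlinarith
  rw [singularInner, Complex.norm_exp, Real.exp_lt_one_iff, ← Complex.ofReal_neg,
    Complex.re_ofReal_mul]
  nlinarith [mul_pos ha hre]

/-- The composition operator with symbol `φ`. -/
def compositionOperator (φ : ℂ → ℂ) (f : ℂ → ℂ) : ℂ → ℂ :=
  f ∘ φ

/-- The `Δ₂`-condition. -/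
def DeltaTwo (β : ℕ → ℝ) : Prop :=
  ∃ δ : ℝ, 0 < δ ∧ δ < 1 ∧ ∀ n : ℕ, δ * β n ≤ β (2 * n)

/-!
Put `f = I_1 ^ N` with Taylor coefficients `c m`. By the closed graph theorem the composition
operator is bounded (`exists_bound_of_mapsTo`), so that `∑ ‖c m‖ ^ 2 * β m ≤ C * β N`. As `β` is
antitone, it suffices to know that a fixed proportion of the mass `∑ ‖c m‖ ^ 2` sits on indices
`m ≤ θ N` for some `θ < 1`: then `β (θ N) ≤ C' * β N`, and iteration gives `Δ₂`. This is plausible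
because on the unit circle `f` is `exp (-i N cot (t / 2))`, with frequency
`N / (2 sin ^ 2 (t / 2))`, which takes all values from `N / 2` on. Here `θ = 2 / 3`, `N = 15 k`.

To prove it, note that `(1 - z) ^ 2 f' = -2 N f` makes `d m = m * c m` a solution of
`d (m + 1) + d (m - 1) = 2 (1 - N / m) d m` (`singularInner_pow_recurrence`). For `m` between
`3 N / 5` and `6 N` the coefficient `1 - N / m` stays away from `±1` and varies slowly, so a
quadratic energy stays comparable along this range (`recEnergy_le`); hence the mass up to `6 N` is
at most a constant times the mass up to `2 N / 3` (`sum_norm_sq_le_of_recurrence`). Finally,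
Parseval's identity on a circle of radius close to `1` (`HasDiskExpansion.hasSum_sq`) shows that the
mass up to `6 N` is bounded below (`le_sum_norm_sq`).
-/

/-! ### Power series on the unit disk -/

theorem hasSum_mul_conj {u : ℕ → ℂ} {s : ℂ} (hu : HasSum u s)
    (hn : Summable (fun n => ‖u n‖)) :
    HasSum (fun p : ℕ × ℕ => u p.1 * (starRingEnd ℂ) (u p.2)) ((‖s‖ ^ 2 : ℝ) : ℂ) := by
  have hn' : Summable (fun n => ‖(starRingEnd ℂ) (u n)‖) := by
    simpa only [RCLike.norm_conj] using hn
  have hs : Summable (fun p : ℕ × ℕ => u p.1 * (starRingEnd ℂ) (u p.2)) :=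
    summable_mul_of_summable_norm (f := u) (g := fun n => (starRingEnd ℂ) (u n)) hn hn'
  have h := HasSum.mul hu (Complex.hasSum_conj'.mpr hu) hs
  rwa [Complex.mul_conj, Complex.normSq_eq_norm_sq] at h

/-- `f` is given on the open unit disk by the power series with coefficients `a`. -/
def HasDiskExpansion (a : ℕ → ℂ) (f : ℂ → ℂ) : Prop :=
  ∀ z ∈ Metric.ball (0 : ℂ) 1, HasSum (fun n => a n * z ^ n) (f z)

namespace HasDiskExpansion

variable {a b : ℕ → ℂ} {f g : ℂ → ℂ}

theorem congr (ha : HasDiskExpansion a f) (h : EqOn f g (Metric.ball 0 1)) :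
    HasDiskExpansion a g := fun z hz => h hz ▸ ha z hz

theorem add (ha : HasDiskExpansion a f) (hb : HasDiskExpansion b g) :
    HasDiskExpansion (a + b) (f + g) := fun z hz => by
  simpa [add_mul] using (ha z hz).add (hb z hz)

theorem const_mul (ha : HasDiskExpansion a f) (c : ℂ) :
    HasDiskExpansion (fun n => c * a n) (fun z => c * f z) := fun z hz => by
  simpa [mul_assoc] using (ha z hz).mul_left c

theorem unique (ha : HasDiskExpansion a f) (hb : HasDiskExpansion b f) : a = b := by
  have key : ∀ {c : ℕ → ℂ}, HasDiskExpansion c f →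
      HasFPowerSeriesAt f (FormalMultilinearSeries.ofScalars ℂ c) 0 := by
    intro c hc
    rw [hasFPowerSeriesAt_iff]
    filter_upwards [Metric.ball_mem_nhds (0 : ℂ) one_pos] with z hz
    simpa [FormalMultilinearSeries.coeff_ofScalars, mul_comm] using hc z hz
  exact FormalMultilinearSeries.ofScalars_series_injective ℂ ℂ
    ((key ha).eq_formalMultilinearSeries (key hb))

/-- Multiplication by `z` shifts the coefficients. -/
theorem mul_id (ha : HasDiskExpansion a f) :
    HasDiskExpansion (fun n => if n = 0 then 0 else a (n - 1)) (fun z => z * f z) := by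
  intro z hz
  rw [← hasSum_nat_add_iff' 1]
  simpa [pow_succ, mul_comm, mul_left_comm, mul_assoc] using (ha z hz).mul_left z

theorem of_differentiableOn (hf : DifferentiableOn ℂ f (Metric.ball 0 1)) :
    HasDiskExpansion (fun n => (n.factorial : ℂ)⁻¹ * iteratedDeriv n f 0) f := by
  intro z hz
  simpa [mul_assoc, mul_comm, mul_left_comm] using Complex.hasSum_taylorSeries_on_ball hf hz

theorem deriv (ha : HasDiskExpansion a f) (hf : DifferentiableOn ℂ f (Metric.ball 0 1)) :
    HasDiskExpansion (fun n => (n + 1 : ℂ) * a (n + 1)) (deriv f) := by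
  rw [ha.unique (of_differentiableOn hf)]
  convert of_differentiableOn (hf.deriv Metric.isOpen_ball) using 2 with n
  simp only [iteratedDeriv_succ', Nat.factorial_succ]
  have : (n + 1 : ℂ) ≠ 0 := by exact_mod_cast n.succ_ne_zero
  push_cast
  field_simp

theorem summable_norm (ha : HasDiskExpansion a f) {r : ℝ} (hr0 : 0 ≤ r) (hr : r < 1) :
    Summable (fun n => ‖a n‖ * r ^ n) := by
  have h := (ha (r : ℂ) (by simp [abs_of_nonneg hr0, hr])).summable.norm
  simpa [abs_of_nonneg hr0] using h

open Complex in
/-- Parseval's identity for a power series on a circle of radius `r < 1`. -/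
theorem hasSum_sq (ha : HasDiskExpansion a f) {r : ℝ} (hr0 : 0 ≤ r) (hr : r < 1) :
    HasSum (fun n => ‖a n‖ ^ 2 * (r ^ 2) ^ n)
      ((2 * Real.pi)⁻¹ * ∫ t in (0 : ℝ)..2 * Real.pi, ‖f (r * exp (t * I))‖ ^ 2) := by
  have hb := ha.summable_norm hr0 hr
  have hF : ∀ t : ℝ, HasSum (fun n => a n * (r * exp (t * I)) ^ n) (f (r * exp (t * I))) := by
    intro t
    apply ha
    simp [norm_exp_ofReal_mul_I, abs_of_nonneg hr0, hr]
  have hnorm : ∀ (t : ℝ) n, ‖a n * (r * exp (t * I)) ^ n‖ = ‖a n‖ * r ^ n := by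
    intro t n
    simp [norm_exp_ofReal_mul_I, abs_of_nonneg hr0]
  -- integrate the double series of `f * conj f` termwise: only the diagonal survives
  let G : ℕ × ℕ → ℝ → ℂ := fun p t =>
    (a p.1 * (r * exp (t * I)) ^ p.1) * (starRingEnd ℂ) (a p.2 * (r * exp (t * I)) ^ p.2)
  have hprod : ∀ t : ℝ, HasSum (fun p => G p t) ((‖f (r * exp (t * I))‖ ^ 2 : ℝ) : ℂ) := by
    intro t
    have h2 : Summable fun n => ‖a n * (r * exp (t * I)) ^ n‖ := by
      simp only [hnorm]
      exact hb
    have h := hasSum_mul_conj (hF t) h2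
    exact h
  have hG : ∀ p t, G p t = a p.1 * (starRingEnd ℂ) (a p.2) * (r : ℂ) ^ (p.1 + p.2) *
      exp ((((p.1 : ℤ) - p.2 : ℤ) : ℂ) * I * t) := by
    intro p t
    simp only [G, map_mul, map_pow, conj_ofReal, ← exp_conj, conj_I, mul_pow, ← exp_nat_mul,
      map_natCast]
    rw [pow_add, show ((((p.1 : ℤ) - p.2 : ℤ) : ℂ) * I * t) =
      p.1 * (t * I) + p.2 * (t * -I) by push_cast; ring, exp_add]
    ring
  have hint := intervalIntegral.hasSum_integral_of_dominated_convergence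
    (μ := MeasureTheory.volume) (a := 0) (b := 2 * Real.pi) (F := G)
    (f := fun t => ((‖f (r * exp (t * I))‖ ^ 2 : ℝ) : ℂ))
    (fun p _ => (‖a p.1‖ * r ^ p.1) * (‖a p.2‖ * r ^ p.2))
    (fun p => Continuous.aestronglyMeasurable (by fun_prop))
    (fun p => Eventually.of_forall fun t _ => by
      simp only [G, norm_mul, RCLike.norm_conj, ← hnorm t]; simp)
    (Eventually.of_forall fun t _ => Summable.mul_of_nonneg hb hb
      (fun n => by positivity) (fun n => by positivity))
    (by simp)
    (Eventually.of_forall fun t _ => hprod t)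
  have hpi : (2 * Real.pi : ℝ) ≠ 0 := by positivity
  have hval : ∀ p : ℕ × ℕ, ∫ t in (0 : ℝ)..2 * Real.pi, G p t =
      if p.1 = p.2 then ((2 * Real.pi * (‖a p.1‖ ^ 2 * (r ^ 2) ^ p.1) : ℝ) : ℂ) else 0 := by
    intro p
    simp only [hG]
    rw [intervalIntegral.integral_const_mul]
    split_ifs with h
    · simp only [h, sub_self, Int.cast_zero, zero_mul, exp_zero,
        intervalIntegral.integral_const, mul_conj, normSq_eq_norm_sq, sub_zero]
      rw [← pow_mul, two_mul p.2]
      simp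
      ring
    · have hne : (((p.1 : ℤ) - p.2 : ℤ) : ℂ) * I ≠ 0 := by
        refine mul_ne_zero ?_ I_ne_zero
        exact Int.cast_ne_zero.mpr (sub_ne_zero.mpr (Nat.cast_injective.ne h))
      rw [integral_exp_mul_complex hne, show (((p.1 : ℤ) - p.2 : ℤ) : ℂ) * I *
        ((2 * Real.pi : ℝ) : ℂ) = (((p.1 : ℤ) - p.2 : ℤ) : ℂ) * (2 * Real.pi * I) by
          push_cast; ring, exp_int_mul_two_pi_mul_I]
      simp
  simp only [hval] at hint
  have hinj : Function.Injective (fun n : ℕ => (n, n)) := fun m n h => (Prod.ext_iff.mp h).1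
  rw [← hinj.hasSum_iff (by
    rintro ⟨m, n⟩ hmn
    have : m ≠ n := fun h => hmn ⟨m, by simp [h]⟩
    simp [this])] at hint
  simp only [Function.comp_def, if_true] at hint
  rw [intervalIntegral.integral_ofReal, hasSum_ofReal] at hint
  have := hint.mul_left (2 * Real.pi)⁻¹
  simpa only [inv_mul_cancel_left₀ hpi] using this

end HasDiskExpansion

/-! ### Energy estimate for a three-term recurrence -/

/-- The quadratic form `u² + v² - 2 x u v` is comparable to `u² + v²` when `|x| ≤ 5 / 6`. -/
theorem sq_add_sq_le_of_abs_le {x u v : ℝ} (h1 : -(5 / 6) ≤ x) (h2 : x ≤ 5 / 6) :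
    u ^ 2 + v ^ 2 ≤ 6 * (u ^ 2 + v ^ 2 - 2 * x * u * v) ∧
      u ^ 2 + v ^ 2 - 2 * x * u * v ≤ 2 * (u ^ 2 + v ^ 2) := by
  constructor <;>
  nlinarith [mul_nonneg (by linarith : 0 ≤ 5 / 6 - x) (sq_nonneg (u + v)),
    mul_nonneg (by linarith : 0 ≤ x + 5 / 6) (sq_nonneg (u - v)), sq_nonneg (u + v),
    sq_nonneg (u - v)]

/-- The energy at `m` of a solution `d` of the recurrence
`d (m + 1) + d (m - 1) = 2 (1 - N / m) d m`. -/
noncomputable def recEnergy (N : ℝ) (d : ℕ → ℝ) (m : ℕ) : ℝ :=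
  d m ^ 2 + d (m + 1) ^ 2 - 2 * (1 - N / m) * d m * d (m + 1)

section

variable {k : ℕ} {d : ℕ → ℝ}

/-- For `N = 15 k` and `9 k ≤ m ≤ 90 k` the parameter `1 - N / m` lies in `[-2 / 3, 5 / 6]`: the
recurrence oscillates there, and the energy controls `d m` and `d (m + 1)`. -/
theorem recEnergy_bounds (hk : 0 < k) {m : ℕ} (h1 : 9 * k ≤ m) (h2 : m ≤ 90 * k) :
    d m ^ 2 + d (m + 1) ^ 2 ≤ 6 * recEnergy (15 * k) d m ∧
      recEnergy (15 * k) d m ≤ 2 * (d m ^ 2 + d (m + 1) ^ 2) := by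
  have hk' : (0 : ℝ) < k := by exact_mod_cast hk
  have h1' : (9 * k : ℝ) ≤ m := by exact_mod_cast h1
  have h2' : (m : ℝ) ≤ 90 * k := by exact_mod_cast h2
  have hm : (0 : ℝ) < m := by linarith
  apply sq_add_sq_le_of_abs_le
  · have : 15 * (k : ℝ) / m ≤ 11 / 6 := by rw [div_le_iff₀ hm]; linarith
    linarith
  · have : 1 / 6 ≤ 15 * (k : ℝ) / m := by rw [le_div_iff₀ hm]; linarith
    linarith

/-- The energy changes only through the variation of `1 - N / m`, which is `O(1 / k)` per step. -/
theorem recEnergy_succ_le (hk : 0 < k)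
    (hd : ∀ m : ℕ, d (m + 2) + d m = 2 * (1 - 15 * k / ((m + 1 : ℕ) : ℝ)) * d (m + 1))
    {m : ℕ} (h1 : 9 * k ≤ m) (h2 : m ≤ 90 * k) :
    recEnergy (15 * k) d (m + 1) ≤ (1 + 2 / k) * recEnergy (15 * k) d m := by
  have hk' : (0 : ℝ) < k := by exact_mod_cast hk
  have h1' : (9 * k : ℝ) ≤ m := by exact_mod_cast h1
  have hm : (0 : ℝ) < m := by linarith
  have hE := (recEnergy_bounds (d := d) hk h1 h2).1
  -- the recurrence turns the energy at `m + 1` into the form at `m` with a shifted parameter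
  have hdiff : recEnergy (15 * k) d (m + 1) = recEnergy (15 * k) d m -
      2 * (15 * k / (m * (m + 1))) * (d m * d (m + 1)) := by
    have h3 : d (m + 1 + 1) = 2 * (1 - 15 * k / ((m + 1 : ℕ) : ℝ)) * d (m + 1) - d m := by
      linarith [hd m]
    rw [recEnergy, recEnergy, h3]
    push_cast
    field_simp
    ring
  have hq : 15 * (k : ℝ) / (m * (m + 1)) ≤ 1 / (3 * k) := by
    rw [div_le_div_iff₀ (by positivity) (by positivity)]
    nlinarith
  have hq0 : 0 ≤ 15 * (k : ℝ) / (m * (m + 1)) := by positivity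
  have h4 : -(2 * (15 * k / (m * (m + 1))) * (d m * d (m + 1))) ≤
      1 / (3 * k) * (d m ^ 2 + d (m + 1) ^ 2) := by
    calc _ = 15 * (k : ℝ) / (m * (m + 1)) * (-(2 * (d m * d (m + 1)))) := by ring
      _ ≤ 15 * (k : ℝ) / (m * (m + 1)) * (d m ^ 2 + d (m + 1) ^ 2) := by
        gcongr
        nlinarith [sq_nonneg (d m + d (m + 1))]
      _ ≤ _ := by gcongr
  calc _ = recEnergy (15 * k) d m +
        -(2 * (15 * k / (m * (m + 1))) * (d m * d (m + 1))) := by rw [hdiff]; ring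
    _ ≤ recEnergy (15 * k) d m + 1 / (3 * k) * (6 * recEnergy (15 * k) d m) := by
      gcongr
      exact h4.trans (by gcongr)
    _ = _ := by field_simp; ring

/-- From `m` to `m'` there are at most `81 k` steps, and `(1 + 2 / k) ^ (81 k) ≤ exp 162`. -/
theorem recEnergy_le (hk : 0 < k)
    (hd : ∀ m : ℕ, d (m + 2) + d m = 2 * (1 - 15 * k / ((m + 1 : ℕ) : ℝ)) * d (m + 1))
    {m m' : ℕ} (h1 : 9 * k ≤ m) (hmm : m ≤ m') (h2 : m' ≤ 90 * k) :
    recEnergy (15 * k) d m' ≤ Real.exp 162 * recEnergy (15 * k) d m := by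
  have hk' : (0 : ℝ) < k := by exact_mod_cast hk
  obtain ⟨j, rfl⟩ := Nat.exists_eq_add_of_le hmm
  have hE : 0 ≤ recEnergy (15 * k) d m := by
    nlinarith [(recEnergy_bounds (d := d) hk h1 (hmm.trans h2)).1, sq_nonneg (d m),
      sq_nonneg (d (m + 1))]
  have key : ∀ i ≤ j, recEnergy (15 * k) d (m + i) ≤
      (1 + 2 / k) ^ i * recEnergy (15 * k) d m := by
    intro i
    induction i with
    | zero => simp
    | succ i ih =>
      intro hi
      calc _ ≤ (1 + 2 / k) * recEnergy (15 * k) d (m + i) :=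
            recEnergy_succ_le hk hd (by omega) (by omega)
        _ ≤ (1 + 2 / k) * ((1 + 2 / k) ^ i * recEnergy (15 * k) d m) := by
            gcongr
            exact ih (by omega)
        _ = _ := by ring
  refine (key j le_rfl).trans ?_
  gcongr
  have hj : (j : ℝ) ≤ 81 * k := by
    have : j ≤ 81 * k := by omega
    exact_mod_cast this
  calc (1 + 2 / (k : ℝ)) ^ j ≤ Real.exp (2 / k) ^ j := by
        gcongr
        linarith [Real.add_one_le_exp (2 / (k : ℝ))]
    _ = Real.exp (j * (2 / k)) := (Real.exp_nat_mul _ _).symm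
    _ ≤ Real.exp 162 := by
        gcongr
        rw [← mul_div_assoc, div_le_iff₀ hk']
        linarith

/-- The hypothesis is the recurrence for `d m = m * c m`, shifted by one and cleared of
denominators. -/
theorem sq_le_of_recurrence_real (hk : 0 < k) {c : ℕ → ℝ}
    (hc : ∀ m : ℕ, (m + 2 : ℝ) * c (m + 2) + m * c m = 2 * (m + 1 - 15 * k) * c (m + 1))
    {m m' : ℕ} (h1 : 9 * k ≤ m) (hm : m < 10 * k) (hmm : m ≤ m') (h2 : m' ≤ 90 * k) :
    c m' ^ 2 ≤ 15 * Real.exp 162 * (c m ^ 2 + c (m + 1) ^ 2) := by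
  have hk' : (0 : ℝ) < k := by exact_mod_cast hk
  have hd : ∀ m : ℕ, (fun m : ℕ => m * c m) (m + 2) + (fun m : ℕ => m * c m) m =
      2 * (1 - 15 * k / ((m + 1 : ℕ) : ℝ)) * (fun m : ℕ => m * c m) (m + 1) := by
    intro m
    push_cast
    rw [hc m]
    field_simp
  have e1 := (recEnergy_bounds (d := fun m : ℕ => m * c m) hk (h1.trans hmm) h2).1
  have e2 := recEnergy_le (d := fun m : ℕ => m * c m) hk hd h1 hmm h2
  have e3 := (recEnergy_bounds (d := fun m : ℕ => m * c m) hk h1 (hmm.trans h2)).2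
  have b1 : (9 * k : ℝ) ≤ m' := by exact_mod_cast h1.trans hmm
  have b2 : (m : ℝ) ≤ 10 * k := by exact_mod_cast hm.le
  have b3 : ((m + 1 : ℕ) : ℝ) ≤ 10 * k := by exact_mod_cast hm
  have l1 : 81 * k ^ 2 * c m' ^ 2 ≤ (m' * c m') ^ 2 := by
    rw [mul_pow]
    gcongr
    nlinarith
  have l2 : (m * c m) ^ 2 + (((m + 1 : ℕ) : ℝ) * c (m + 1)) ^ 2 ≤
      100 * k ^ 2 * (c m ^ 2 + c (m + 1) ^ 2) := by
    rw [mul_pow, mul_pow, mul_add]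
    gcongr
    · nlinarith
    · nlinarith [Nat.cast_nonneg (α := ℝ) (m + 1)]
  have l3 : 81 * k ^ 2 * c m' ^ 2 ≤
      6 * (Real.exp 162 * (2 * (100 * k ^ 2 * (c m ^ 2 + c (m + 1) ^ 2)))) := by
    calc _ ≤ _ := l1
      _ ≤ _ := le_add_of_nonneg_right (sq_nonneg _)
      _ ≤ _ := e1
      _ ≤ _ := by gcongr; exact e2.trans (by gcongr; exact e3.trans (by gcongr))
  have hA : 0 ≤ Real.exp 162 * (c m ^ 2 + c (m + 1) ^ 2) := by positivity
  have : 81 * (k : ℝ) ^ 2 * c m' ^ 2 ≤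
      81 * k ^ 2 * (15 * Real.exp 162 * (c m ^ 2 + c (m + 1) ^ 2)) := by
    nlinarith [mul_nonneg (sq_nonneg (k : ℝ)) hA]
  exact le_of_mul_le_mul_left this (by positivity)

theorem norm_sq_le_of_recurrence (hk : 0 < k) {c : ℕ → ℂ}
    (hc : ∀ m : ℕ, (m + 2 : ℂ) * c (m + 2) + m * c m = 2 * (m + 1 - 15 * k) * c (m + 1))
    {m m' : ℕ} (h1 : 9 * k ≤ m) (hm : m < 10 * k) (hmm : m ≤ m') (h2 : m' ≤ 90 * k) :
    ‖c m'‖ ^ 2 ≤ 15 * Real.exp 162 * (‖c m‖ ^ 2 + ‖c (m + 1)‖ ^ 2) := by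
  have hre := sq_le_of_recurrence_real (c := fun m => (c m).re) hk
    (fun m => by have := congrArg Complex.re (hc m); simpa using this) h1 hm hmm h2
  have him := sq_le_of_recurrence_real (c := fun m => (c m).im) hk
    (fun m => by have := congrArg Complex.im (hc m); simpa using this) h1 hm hmm h2
  simp only [← Complex.normSq_eq_norm_sq, Complex.normSq_apply]
  linarith

/-- A solution of the recurrence has a fixed proportion of the square sum of its first `90 k` terms
in its first `10 k + 1` terms: each term in `[10 k, 90 k)` is dominated by each pair of
neighbours from the `k` indices in `[9 k, 10 k)`. -/
theorem sum_norm_sq_le_of_recurrence (hk : 0 < k) {c : ℕ → ℂ}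
    (hc : ∀ m : ℕ, (m + 2 : ℂ) * c (m + 2) + m * c m = 2 * (m + 1 - 15 * k) * c (m + 1)) :
    ∑ m ∈ Finset.range (90 * k), ‖c m‖ ^ 2 ≤
      (1 + 2400 * Real.exp 162) * ∑ m ∈ Finset.range (10 * k + 1), ‖c m‖ ^ 2 := by
  have hk' : (0 : ℝ) < k := by exact_mod_cast hk
  set S := ∑ m ∈ Finset.range (10 * k + 1), ‖c m‖ ^ 2 with hS
  set T := ∑ m ∈ Finset.Ico (10 * k) (90 * k), ‖c m‖ ^ 2 with hT
  have h1 : ∀ m ∈ Finset.Ico (9 * k) (10 * k),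
      T ≤ 80 * k * (15 * Real.exp 162 * (‖c m‖ ^ 2 + ‖c (m + 1)‖ ^ 2)) := by
    intro m hm
    rw [Finset.mem_Ico] at hm
    have := Finset.sum_le_card_nsmul (Finset.Ico (10 * k) (90 * k)) (fun i => ‖c i‖ ^ 2)
      (15 * Real.exp 162 * (‖c m‖ ^ 2 + ‖c (m + 1)‖ ^ 2)) (fun i hi => by
        rw [Finset.mem_Ico] at hi
        exact norm_sq_le_of_recurrence hk hc hm.1 hm.2 (by omega) (by omega))
    rw [Nat.card_Ico, ← Nat.sub_mul, nsmul_eq_mul] at this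
    simpa using this
  have h2 : ∑ m ∈ Finset.Ico (9 * k) (10 * k), (‖c m‖ ^ 2 + ‖c (m + 1)‖ ^ 2) ≤ 2 * S := by
    rw [Finset.sum_add_distrib, Finset.sum_Ico_add' (fun i => ‖c i‖ ^ 2), two_mul]
    gcongr <;>
      refine Finset.sum_le_sum_of_subset_of_nonneg (fun i hi => ?_) (fun _ _ _ => by positivity)
    all_goals
      rw [Finset.mem_Ico] at hi
      rw [Finset.mem_range]
      omega
  have h3 : k * T ≤ 80 * k * (15 * Real.exp 162 * (2 * S)) := by
    have := Finset.card_nsmul_le_sum (Finset.Ico (9 * k) (10 * k)) _ T h1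
    rw [Nat.card_Ico, ← Nat.sub_mul, nsmul_eq_mul, ← Finset.mul_sum, ← Finset.mul_sum] at this
    simp only [Nat.reduceSub, one_mul] at this
    exact this.trans (by gcongr)
  have h4 : T ≤ 2400 * Real.exp 162 * S := by
    refine le_of_mul_le_mul_left (h3.trans_eq ?_) hk'
    ring
  rw [← Finset.sum_range_add_sum_Ico _ (by omega : 10 * k ≤ 90 * k), ← hT, add_mul, one_mul]
  gcongr
  exact Finset.sum_le_sum_of_subset_of_nonneg (Finset.range_mono (by omega))
    (fun _ _ _ => by positivity)

end

/-! ### Boundedness of composition operators -/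

theorem IsHardyWeight.summable_pow_div {β : ℕ → ℝ} (hβ : IsHardyWeight β) {r : ℝ} (hr0 : 0 ≤ r)
    (hr : r < 1) : Summable (fun n => r ^ n / β n) := by
  obtain ⟨ρ, hrρ, hρ1⟩ := exists_between hr
  have hρ0 : 0 < ρ := hr0.trans_lt hrρ
  have hlt : ((ρ : ℝ) : EReal) < liminf (fun n : ℕ => ((β n ^ (1 / (n : ℝ)) : ℝ) : EReal)) atTop :=
    lt_of_lt_of_le (by exact_mod_cast hρ1) hβ.one_le_liminf
  have hev := (eventually_lt_of_lt_liminf hlt).and (eventually_ge_atTop 1)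
  have hgeom : Summable (fun n : ℕ => (r / ρ) ^ n) :=
    summable_geometric_of_lt_one (by positivity) ((div_lt_one hρ0).mpr hrρ)
  refine Summable.of_norm_bounded_eventually_nat hgeom ?_
  filter_upwards [hev] with n hn
  have h1 : ρ < β n ^ (1 / (n : ℝ)) := by exact_mod_cast hn.1
  have hn0 : n ≠ 0 := by omega
  have h2 : ρ ^ n ≤ β n := by
    calc ρ ^ n ≤ (β n ^ (1 / (n : ℝ))) ^ n := by gcongr
      _ = β n := by rw [one_div, Real.rpow_inv_natCast_pow (hβ.pos n).le hn0]
  have := hβ.pos n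
  rw [Real.norm_of_nonneg (by positivity), div_pow]
  gcongr

/-- In the isometric copy `ℓ²` of `H²(β)`, where `x` stands for `∑ (x n / √β n) z ^ n`, evaluation
at a point `w` of the disk is the inner product with a kernel vector. -/
theorem IsHardyWeight.exists_kernel {β : ℕ → ℝ} (hβ : IsHardyWeight β) {w : ℂ}
    (hw : w ∈ Metric.ball (0 : ℂ) 1) :
    ∃ K : lp (fun _ : ℕ => ℂ) 2, ∀ x : lp (fun _ : ℕ => ℂ) 2,
      HasSum (fun n => x n / (√(β n) : ℂ) * w ^ n) (inner ℂ K x) := by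
  rw [mem_ball_zero_iff] at hw
  have hs := hβ.summable_pow_div (sq_nonneg ‖w‖) (by nlinarith [norm_nonneg w])
  have hmem : Memℓp (fun n => (starRingEnd ℂ) (w ^ n / (√(β n) : ℂ))) 2 := by
    apply memℓp_gen
    refine hs.congr fun n => ?_
    rw [RCLike.norm_conj, norm_div, Complex.norm_real, Real.norm_of_nonneg (Real.sqrt_nonneg _)]
    simp only [ENNReal.toReal_ofNat, Real.rpow_ofNat, div_pow, norm_pow]
    rw [Real.sq_sqrt (hβ.pos n).le, pow_right_comm]
  refine ⟨⟨_, hmem⟩, fun x => ?_⟩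
  have h := lp.hasSum_inner (𝕜 := ℂ) (⟨_, hmem⟩ : lp (fun _ : ℕ => ℂ) 2) x
  rwa [funext fun n => show x n / (√(β n) : ℂ) * w ^ n =
    inner ℂ ((starRingEnd ℂ) (w ^ n / (√(β n) : ℂ))) (x n) by
      rw [RCLike.inner_apply, starRingEnd_self_apply, div_mul_eq_mul_div, mul_div_assoc]]

/-- A composition operator that maps `H²(β)` into itself is bounded: it has closed graph because
point evaluations are continuous and separate the points. The bound is stated on the monomials,
whose images are the powers `φ ^ n`, and on finite sums, so that no summability is needed. -/
theorem exists_bound_of_mapsTo {β : ℕ → ℝ} (hβ : IsHardyWeight β) {φ : ℂ → ℂ}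
    (hφ : MapsTo φ (Metric.ball (0 : ℂ) 1) (Metric.ball (0 : ℂ) 1))
    (hmaps : MapsTo (compositionOperator φ) (weightedHardySpace β) (weightedHardySpace β)) :
    ∃ C : ℝ, ∀ (n : ℕ) (c : ℕ → ℂ), HasDiskExpansion c (fun z => φ z ^ n) →
      ∀ s : Finset ℕ, ∑ m ∈ s, ‖c m‖ ^ 2 * β m ≤ C * β n := by
  have hsq : ∀ n, (√(β n) : ℂ) ≠ 0 := fun n => by
    exact_mod_cast (Real.sqrt_pos.mpr (hβ.pos n)).ne'
  have hKex : ∀ w ∈ Metric.ball (0 : ℂ) 1, ∃ K : lp (fun _ : ℕ => ℂ) 2,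
      ∀ x : lp (fun _ : ℕ => ℂ) 2,
        HasSum (fun n => x n / (√(β n) : ℂ) * w ^ n) (inner ℂ K x) := fun w hw =>
    hβ.exists_kernel hw
  choose! K hK using hKex
  have hexp : ∀ x : lp (fun _ : ℕ => ℂ) 2,
      HasDiskExpansion (fun n => x n / (√(β n) : ℂ)) (fun z => inner ℂ (K z) x) :=
    fun x z hz => hK z hz x
  -- evaluations separate the points of `ℓ²`
  have hsep : ∀ x y : lp (fun _ : ℕ => ℂ) 2,
      (∀ z ∈ Metric.ball (0 : ℂ) 1, inner ℂ (K z) x = inner ℂ (K z) y) → x = y := by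
    intro x y h
    have := (hexp x).unique ((hexp y).congr fun z hz => (h z hz).symm)
    ext n
    have hn := congrFun this n
    simpa [div_left_inj' (hsq n)] using hn
  have hTex : ∀ x : lp (fun _ : ℕ => ℂ) 2, ∃ y : lp (fun _ : ℕ => ℂ) 2,
      ∀ z ∈ Metric.ball (0 : ℂ) 1, inner ℂ (K z) y = inner ℂ (K (φ z)) x := by
    intro x
    have hx : (fun z => inner ℂ (K z) x) ∈ weightedHardySpace β := by
      refine ⟨_, hexp x, ?_⟩
      refine ((lp.memℓp x).summable (by norm_num)).congr fun n => ?_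
      rw [norm_div, Complex.norm_real, Real.norm_of_nonneg (Real.sqrt_nonneg _), div_pow,
        Real.sq_sqrt (hβ.pos n).le, div_mul_cancel₀ _ (hβ.pos n).ne']
      simp
    obtain ⟨b, hb, hbs⟩ := hmaps hx
    have hmem : Memℓp (fun n => b n * (√(β n) : ℂ)) 2 := by
      apply memℓp_gen
      refine hbs.congr fun n => ?_
      rw [norm_mul, Complex.norm_real, Real.norm_of_nonneg (Real.sqrt_nonneg _)]
      simp only [ENNReal.toReal_ofNat, Real.rpow_ofNat, mul_pow]
      rw [Real.sq_sqrt (hβ.pos n).le]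
    refine ⟨⟨_, hmem⟩, fun z hz => ?_⟩
    refine (hK z hz ⟨_, hmem⟩).unique ?_
    simpa [mul_div_cancel_right₀ _ (hsq _), compositionOperator] using hb z hz
  choose T₀ hT₀ using hTex
  let T : lp (fun _ : ℕ => ℂ) 2 →ₗ[ℂ] lp (fun _ : ℕ => ℂ) 2 :=
    { toFun := T₀
      map_add' := fun x y => hsep _ _ fun z hz => by
        rw [inner_add_right, hT₀ _ z hz, hT₀ _ z hz, hT₀ _ z hz, inner_add_right]
      map_smul' := fun a x => hsep _ _ fun z hz => by
        rw [RingHom.id_apply, inner_smul_right, hT₀ _ z hz, hT₀ _ z hz, inner_smul_right] }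
  have hT : ∀ x, ∀ z ∈ Metric.ball (0 : ℂ) 1, inner ℂ (K z) (T x) = inner ℂ (K (φ z)) x := hT₀
  let S : lp (fun _ : ℕ => ℂ) 2 →L[ℂ] lp (fun _ : ℕ => ℂ) 2 :=
    ContinuousLinearMap.ofSeqClosedGraph (g := T) fun u x y hu hTu => hsep _ _ fun z hz => by
      have h1 : Tendsto (fun i => (inner ℂ (K z) (T (u i)) : ℂ)) atTop (nhds (inner ℂ (K z) y)) :=
        tendsto_const_nhds.inner hTu
      have h2 : Tendsto (fun i => (inner ℂ (K (φ z)) (u i) : ℂ)) atTop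
          (nhds (inner ℂ (K (φ z)) x)) := tendsto_const_nhds.inner hu
      simp only [hT _ z hz] at h1
      rw [hT _ z hz]
      exact tendsto_nhds_unique h1 h2
  have hS : ∀ x, ∀ z ∈ Metric.ball (0 : ℂ) 1, inner ℂ (K z) (S x) = inner ℂ (K (φ z)) x := hT₀
  refine ⟨‖S‖ ^ 2, fun n c hc s => ?_⟩
  -- the vector of `ℓ²` that stands for `z ^ n`
  set x : lp (fun _ : ℕ => ℂ) 2 := lp.single 2 n (√(β n) : ℂ) with hx
  have hxn : ‖x‖ = √(β n) := by
    rw [hx, lp.norm_single (by norm_num), Complex.norm_real,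
      Real.norm_of_nonneg (Real.sqrt_nonneg _)]
  have hxe : ∀ w ∈ Metric.ball (0 : ℂ) 1, inner ℂ (K w) x = w ^ n := by
    intro w hw
    refine (hK w hw x).unique ?_
    convert hasSum_ite_eq n (w ^ n) using 2 with m
    by_cases h : m = n
    · subst h
      simp [hx, lp.single_apply, hsq]
    · simp [hx, lp.single_apply, h]
  have hcoef := (hexp (S x)).unique (hc.congr fun z hz => by
    rw [hS x z hz, hxe _ (hφ hz)])
  have hterm : ∀ m, ‖c m‖ ^ 2 * β m = ‖S x m‖ ^ (2 : ENNReal).toReal := by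
    intro m
    rw [← congrFun hcoef m, norm_div, Complex.norm_real,
      Real.norm_of_nonneg (Real.sqrt_nonneg _), div_pow, Real.sq_sqrt (hβ.pos m).le,
      div_mul_cancel₀ _ (hβ.pos m).ne']
    simp
  simp only [hterm]
  refine (lp.sum_rpow_le_norm_rpow (by norm_num) (S x) s).trans ?_
  simp only [ENNReal.toReal_ofNat, Real.rpow_ofNat]
  calc ‖S x‖ ^ 2 ≤ (‖S‖ * ‖x‖) ^ 2 := by gcongr; exact S.le_opNorm x
    _ = _ := by rw [hxn, mul_pow, Real.sq_sqrt (hβ.pos n).le]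

/-! ### Coefficients of the powers of the singular inner function -/

theorem one_sub_ne_zero_of_mem_ball {z : ℂ} (hz : z ∈ Metric.ball (0 : ℂ) 1) : 1 - z ≠ 0 := by
  rintro h
  rw [← sub_eq_zero.mp h] at hz
  simp at hz

theorem differentiableOn_singularInner_pow (a : ℝ) (N : ℕ) :
    DifferentiableOn ℂ (fun z => singularInner a z ^ N) (Metric.ball 0 1) := by
  intro z hz
  have := one_sub_ne_zero_of_mem_ball hz
  unfold singularInner
  exact DifferentiableAt.differentiableWithinAt (by fun_prop (disch := assumption))

theorem one_sub_sq_mul_deriv_singularInner_pow (N : ℕ) {z : ℂ}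
    (hz : z ∈ Metric.ball (0 : ℂ) 1) :
    (1 - z) ^ 2 * deriv (fun z => singularInner 1 z ^ N) z = -(2 * N) * singularInner 1 z ^ N := by
  have h1 := one_sub_ne_zero_of_mem_ball hz
  have hfun : (fun z => singularInner 1 z ^ N) =
      fun z => Complex.exp (N * (-((1 + z) / (1 - z)))) := by
    ext w
    rw [singularInner, Complex.exp_nat_mul]
    simp
  have hd : HasDerivAt (fun z : ℂ => (N : ℂ) * (-((1 + z) / (1 - z))))
      (N * (-((1 * (1 - z) - (1 + z) * (-1)) / (1 - z) ^ 2))) z :=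
    ((((hasDerivAt_id z).const_add 1).div ((hasDerivAt_id z).const_sub 1) h1).neg).const_mul _
  have hv := congrFun hfun z
  rw [hfun, hd.cexp.deriv, hv]
  field_simp
  ring

/-- The recurrence is the differential equation `(1 - z) ^ 2 f' = -2 N f` for `f = I_1 ^ N`, read
off at `z ^ (m + 1)`. -/
theorem singularInner_pow_recurrence {N : ℕ} {c : ℕ → ℂ}
    (hc : HasDiskExpansion c (fun z => singularInner 1 z ^ N)) (m : ℕ) :
    (m + 2 : ℂ) * c (m + 2) + m * c m = 2 * (m + 1 - N) * c (m + 1) := by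
  have hd := hc.deriv (differentiableOn_singularInner_pow 1 N)
  have hsum := ((hd.add (hd.mul_id.const_mul (-2))).add hd.mul_id.mul_id).add
    (hc.const_mul (2 * N))
  have h0 : HasDiskExpansion (fun _ => 0) (fun _ => 0) := fun z _ => by
    simp [hasSum_zero]
  have huniq := hsum.unique (h0.congr fun z hz => by
    have := one_sub_sq_mul_deriv_singularInner_pow N hz
    simp only [Pi.add_apply]
    linear_combination -this)
  have h := congrFun huniq (m + 1)
  rcases m with _ | m
  · simp at h
    push_cast
    linear_combination h
  · simp at h
    push_cast
    linear_combination h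

theorem norm_singularInner_one (z : ℂ) :
    ‖singularInner 1 z‖ = Real.exp (-((1 - ‖z‖ ^ 2) / ‖1 - z‖ ^ 2)) := by
  rw [singularInner, Complex.norm_exp]
  congr 1
  rw [← Complex.normSq_eq_norm_sq, ← Complex.normSq_eq_norm_sq, ← Complex.ofReal_neg,
    Complex.re_ofReal_mul, Complex.div_re, ← add_div, Complex.normSq_apply z]
  simp
  ring

open Complex in
theorem exp_le_norm_singularInner_pow_sq (N : ℕ) {r t : ℝ} (hr0 : 0 ≤ r) (hr1 : r ≤ 1)
    (ht : Real.cos t ≤ 0) :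
    Real.exp (-(2 * N * (1 - r ^ 2))) ≤ ‖singularInner 1 (r * exp (t * I)) ^ N‖ ^ 2 := by
  have hz : ‖(r * exp (t * I) : ℂ)‖ = r := by
    simp [norm_exp_ofReal_mul_I, abs_of_nonneg hr0]
  have hden : 1 ≤ ‖1 - (r * exp (t * I) : ℂ)‖ ^ 2 := by
    rw [← normSq_eq_norm_sq, normSq_apply]
    simp only [sub_re, sub_im, one_re, one_im, re_ofReal_mul, im_ofReal_mul,
      exp_ofReal_mul_I_re, exp_ofReal_mul_I_im]
    nlinarith [Real.sin_sq_add_cos_sq t, mul_nonneg hr0 (neg_nonneg.mpr ht), sq_nonneg r]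
  rw [norm_pow, norm_singularInner_one, hz, ← pow_mul, ← Real.exp_nat_mul]
  gcongr
  have : (1 - r ^ 2) / ‖1 - (r * exp (t * I) : ℂ)‖ ^ 2 ≤ 1 - r ^ 2 :=
    div_le_self (by nlinarith) hden
  push_cast
  nlinarith [mul_le_mul_of_nonneg_left this (Nat.cast_nonneg (α := ℝ) N)]

section Mass

variable {N : ℕ} {c : ℕ → ℂ}

open Complex in
theorem continuous_norm_singularInner_pow_sq (N : ℕ) {r : ℝ} (hr0 : 0 ≤ r) (hr : r < 1) :
    Continuous fun t : ℝ => ‖singularInner 1 (r * exp (t * I)) ^ N‖ ^ 2 := by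
  refine ((differentiableOn_singularInner_pow 1 N).continuousOn.comp_continuous
    (f := fun t : ℝ => (r * exp (t * I) : ℂ)) (by fun_prop) fun t => ?_).norm.pow 2
  simp [norm_exp_ofReal_mul_I, abs_of_nonneg hr0, hr]

open Complex in
/-- Parseval's identity on circles of radius tending to `1`, as `|I_1| ≤ 1`. -/
theorem sum_norm_sq_le_one (hc : HasDiskExpansion c (fun z => singularInner 1 z ^ N))
    (s : Finset ℕ) : ∑ m ∈ s, ‖c m‖ ^ 2 ≤ 1 := by
  have hr : ∀ r ∈ Ico (0 : ℝ) 1, ∑ m ∈ s, ‖c m‖ ^ 2 * (r ^ 2) ^ m ≤ 1 := by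
    intro r ⟨hr0, hr1⟩
    refine (sum_le_hasSum s (fun m _ => by positivity) (hc.hasSum_sq hr0 hr1)).trans ?_
    have hle : ∫ t in (0 : ℝ)..2 * Real.pi, ‖singularInner 1 (r * exp (t * I)) ^ N‖ ^ 2 ≤
        ∫ t in (0 : ℝ)..2 * Real.pi, (1 : ℝ) := by
      refine intervalIntegral.integral_mono_on (by positivity)
        ((continuous_norm_singularInner_pow_sq N hr0 hr1).intervalIntegrable _ _)
        (by simp) fun t _ => ?_
      have hb := singularInner_mapsTo one_pos (x := (r * exp (t * I) : ℂ))
        (by simp [norm_exp_ofReal_mul_I, abs_of_nonneg hr0, hr1])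
      rw [mem_ball_zero_iff] at hb
      rw [norm_pow, ← pow_mul]
      exact pow_le_one₀ (norm_nonneg _) hb.le
    rw [inv_mul_le_iff₀ (by positivity)]
    simpa using hle
  have hlim : Tendsto (fun r : ℝ => ∑ m ∈ s, ‖c m‖ ^ 2 * (r ^ 2) ^ m) (nhdsWithin 1 (Iio 1))
      (nhds (∑ m ∈ s, ‖c m‖ ^ 2)) := by
    have : Continuous (fun r : ℝ => ∑ m ∈ s, ‖c m‖ ^ 2 * (r ^ 2) ^ m) := by fun_prop
    simpa using (this.tendsto 1).mono_left nhdsWithin_le_nhds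
  refine le_of_tendsto hlim ?_
  filter_upwards [Ico_mem_nhdsLT (zero_lt_one' ℝ)] with r hr' using hr r hr'

/-- The coefficients of `I_1 ^ N` have a fixed amount of mass below `6 N`: on the circle of radius
`r` with `r ^ 2 = 1 - 1 / (2 N)` the mean of `|I_1 ^ N| ^ 2` is at least `exp (-1) / 2`, while the
coefficients from `6 N` on contribute at most `r ^ (12 N) ≤ exp (-3)`. -/
theorem le_sum_norm_sq (hN : 0 < N) (hc : HasDiskExpansion c (fun z => singularInner 1 z ^ N)) :
    Real.exp (-1) / 2 - Real.exp (-3) ≤ ∑ m ∈ Finset.range (6 * N), ‖c m‖ ^ 2 := by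
  have hN' : (1 : ℝ) ≤ N := by exact_mod_cast hN
  set ρ : ℝ := 1 - 1 / (2 * N) with hρ
  have hρ0 : 0 ≤ ρ := by
    rw [hρ, sub_nonneg, div_le_one (by positivity)]
    linarith
  have hρ1 : ρ < 1 := by
    rw [hρ, sub_lt_self_iff]
    positivity
  have hr : √ρ ^ 2 = ρ := Real.sq_sqrt hρ0
  have hr1 : √ρ < 1 := by rw [Real.sqrt_lt' one_pos]; simpa
  have hsum := hc.hasSum_sq (Real.sqrt_nonneg ρ) hr1
  rw [hr] at hsum
  have hpi := Real.pi_pos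
  have hcont := continuous_norm_singularInner_pow_sq N (Real.sqrt_nonneg ρ) hr1
  -- on the half circle `Re z ≤ 0` the Poisson kernel is at most `1 - ρ`
  have hlow : Real.exp (-1) / 2 ≤ (2 * Real.pi)⁻¹ * ∫ t in (0 : ℝ)..2 * Real.pi,
      ‖singularInner 1 (√ρ * Complex.exp (t * Complex.I)) ^ N‖ ^ 2 := by
    have h1 : ∫ t in (Real.pi / 2)..(Real.pi + Real.pi / 2), Real.exp (-1) ≤
        ∫ t in (Real.pi / 2)..(Real.pi + Real.pi / 2),
          ‖singularInner 1 (√ρ * Complex.exp (t * Complex.I)) ^ N‖ ^ 2 := by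
      refine intervalIntegral.integral_mono_on (by linarith) (by simp)
        (hcont.intervalIntegrable _ _) fun t ht => ?_
      have h := exp_le_norm_singularInner_pow_sq N (Real.sqrt_nonneg ρ) hr1.le
        (Real.cos_nonpos_of_pi_div_two_le_of_le ht.1 ht.2)
      rw [hr] at h
      convert h using 2
      rw [hρ]
      field_simp
      ring
    have h2 : ∫ t in (Real.pi / 2)..(Real.pi + Real.pi / 2),
          ‖singularInner 1 (√ρ * Complex.exp (t * Complex.I)) ^ N‖ ^ 2 ≤
        ∫ t in (0 : ℝ)..2 * Real.pi, ‖singularInner 1 (√ρ * Complex.exp (t * Complex.I)) ^ N‖ ^ 2 :=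
      intervalIntegral.integral_mono_interval (by positivity) (by linarith) (by linarith)
        (Eventually.of_forall fun t => by positivity) (hcont.intervalIntegrable _ _)
    rw [intervalIntegral.integral_const, smul_eq_mul] at h1
    rw [le_inv_mul_iff₀ (by positivity)]
    linarith
  have htail : ∑' m, ‖c (m + 6 * N)‖ ^ 2 * ρ ^ (m + 6 * N) ≤ Real.exp (-3) := by
    refine Real.tsum_le_of_sum_le (fun m => by positivity) fun s => ?_
    have hpow : ρ ^ (6 * N) ≤ Real.exp (-3) := by
      calc ρ ^ (6 * N) ≤ Real.exp (-(1 / (2 * N))) ^ (6 * N) := by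
            gcongr
            linarith [Real.add_one_le_exp (-(1 / (2 * N) : ℝ))]
        _ = Real.exp (-3) := by
            rw [← Real.exp_nat_mul]
            congr 1
            push_cast
            field_simp
            norm_num
    have h1 := sum_norm_sq_le_one hc (s.map (addRightEmbedding (6 * N)))
    rw [Finset.sum_map] at h1
    simp only [addRightEmbedding_apply] at h1
    calc ∑ m ∈ s, ‖c (m + 6 * N)‖ ^ 2 * ρ ^ (m + 6 * N)
        ≤ ∑ m ∈ s, ‖c (m + 6 * N)‖ ^ 2 * Real.exp (-3) := by
          gcongr with m _
          exact (pow_le_pow_of_le_one hρ0 hρ1.le (Nat.le_add_left _ _)).trans hpow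
      _ ≤ 1 * Real.exp (-3) := by
          rw [← Finset.sum_mul]
          gcongr
      _ = _ := one_mul _
  have hhead : ∑ m ∈ Finset.range (6 * N), ‖c m‖ ^ 2 * ρ ^ m ≤
      ∑ m ∈ Finset.range (6 * N), ‖c m‖ ^ 2 := by
    gcongr with m _
    exact mul_le_of_le_one_right (by positivity) (pow_le_one₀ hρ0 hρ1.le)
  have hsplit := hsum.summable.sum_add_tsum_nat_add (6 * N)
  rw [hsum.tsum_eq] at hsplit
  linarith

end Mass

theorem exp_neg_one_div_two_sub_exp_neg_three_pos : 0 < Real.exp (-1) / 2 - Real.exp (-3) := by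
  have h2 : (2 : ℝ) < Real.exp 2 := by linarith [Real.add_one_lt_exp (two_ne_zero (α := ℝ))]
  have h : Real.exp (-1) = Real.exp 2 * Real.exp (-3) := by rw [← Real.exp_add]; norm_num
  rw [h]
  nlinarith [Real.exp_pos (-3)]

/-! ### The `Δ₂`-condition -/

/-- A bound `β (10 k) ≤ D β (15 k)`, used twice, gives the `Δ₂`-condition, as `(3 / 2) ^ 2 > 2`. -/
theorem DeltaTwo.of_le_mul {β : ℕ → ℝ} (hpos : ∀ n, 0 < β n) (hmono : Antitone β) {D : ℝ}
    (hD : ∀ k : ℕ, 0 < k → β (10 * k) ≤ D * β (15 * k)) : DeltaTwo β := by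
  have hD1 : 0 < D := by
    have := (hpos _).trans_le (hD 1 one_pos)
    exact pos_of_mul_pos_left this (hpos _).le
  -- rounding down to multiples of `10` loses at most `135 / 4` in total, so that the second step
  -- ends at an index `≥ 9 n / 4 - 135 / 4`, which is `≥ 2 n` for `n ≥ 135`
  have hbig : ∀ n, 135 ≤ n → β n ≤ D ^ 2 * β (2 * n) := by
    intro n hn
    calc β n ≤ β (10 * (n / 10)) := hmono (by omega)
      _ ≤ D * β (15 * (n / 10)) := hD _ (by omega)
      _ ≤ D * β (10 * (15 * (n / 10) / 10)) := by gcongr; exact hmono (by omega)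
      _ ≤ D * (D * β (15 * (15 * (n / 10) / 10))) := by gcongr; exact hD _ (by omega)
      _ ≤ D * (D * β (2 * n)) := by gcongr; exact hmono (by omega)
      _ = _ := by ring
  have hβ0 := hpos 0
  have hβ1 := hpos 270
  refine ⟨min (1 / 2) (min (1 / D ^ 2) (β 270 / β 0)), by positivity,
    (min_le_left _ _).trans_lt (by norm_num), fun n => ?_⟩
  rcases le_or_gt 135 n with hn | hn
  · calc _ ≤ 1 / D ^ 2 * β n := by
          gcongr
          · exact (hpos n).le
          · exact (min_le_right _ _).trans (min_le_left _ _)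
      _ ≤ _ := by
          rw [one_div, inv_mul_le_iff₀ (by positivity)]
          exact hbig n hn
  · calc _ ≤ β 270 / β 0 * β n := by
          gcongr
          · exact (hpos n).le
          · exact (min_le_right _ _).trans (min_le_right _ _)
      _ ≤ β 270 / β 0 * β 0 := by gcongr; exact hmono (Nat.zero_le n)
      _ = β 270 := div_mul_cancel₀ _ hβ0.ne'
      _ ≤ _ := hmono (by omega)

theorem theorem6p7 (β : ℕ → ℝ) (hβ : IsHardyWeight β) (hmono : Antitone β)
    (hmaps : MapsTo (compositionOperator (singularInner 1))
      (weightedHardySpace β) (weightedHardySpace β)) :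
    DeltaTwo β := by
  obtain ⟨C, hC⟩ := exists_bound_of_mapsTo hβ (singularInner_mapsTo one_pos) hmaps
  set η := Real.exp (-1) / 2 - Real.exp (-3) with hη
  have hη0 : 0 < η := exp_neg_one_div_two_sub_exp_neg_three_pos
  refine DeltaTwo.of_le_mul hβ.pos hmono
    (D := (1 + 2400 * Real.exp 162) / η * C) fun k hk => ?_
  have hc := HasDiskExpansion.of_differentiableOn (differentiableOn_singularInner_pow 1 (15 * k))
  set c : ℕ → ℂ := fun m => (m.factorial : ℂ)⁻¹ *
    iteratedDeriv m (fun z => singularInner 1 z ^ (15 * k)) 0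
  set S := ∑ m ∈ Finset.range (10 * k + 1), ‖c m‖ ^ 2 with hS
  have h1 : η ≤ (1 + 2400 * Real.exp 162) * S := by
    refine (le_sum_norm_sq (by omega) hc).trans ?_
    rw [← mul_assoc]
    exact sum_norm_sq_le_of_recurrence hk fun m => by
      simpa using singularInner_pow_recurrence hc m
  have h2 : S * β (10 * k) ≤ C * β (15 * k) := by
    refine le_trans ?_ (hC (15 * k) c hc (Finset.range (10 * k + 1)))
    rw [hS, Finset.sum_mul]
    refine Finset.sum_le_sum fun m hm => ?_
    gcongr
    exact hmono (by rw [Finset.mem_range] at hm; omega)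
  rw [div_mul_eq_mul_div, div_mul_eq_mul_div, le_div_iff₀ hη0]
  calc β (10 * k) * η ≤ β (10 * k) * ((1 + 2400 * Real.exp 162) * S) := by
        gcongr
        exact (hβ.pos _).le
    _ = (1 + 2400 * Real.exp 162) * (S * β (10 * k)) := by ring
    _ ≤ (1 + 2400 * Real.exp 162) * (C * β (15 * k)) := by gcongr
    _ = _ := by ring
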